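/- \textbf{Setting.} Let $\sigma_x,\sigma_y,\sigma_z$ be the Pauli matrices. A local unitary operator on $\mathbb C^2\otimes\mathbb C^2$ is $A\otimes B$ with $A,B\in \mathrm{SU}(2)$. Let $\mathfrak p$ be the real span of the nine matrices $\tfrac i2\,\sigma_j\otimes\sigma_k$ ($j,k\in\{x,y,z\}$), and let $\mathfrak a\subset\mathfrak p$ be the real span of $X_7=\tfrac i2\sigma_x\otimes\sigma_x$, $X_8=\tfrac i2\sigma_y\otimes\sigma_y$, $X_9=\tfrac i2\sigma_z\otimes\sigma_z$. A two-qubit Hamilton operator $H$ is called non-local (without local terms) if $iH\in\mathfrak p$. The closed fundamental Weyl chamber of $\mathfrak a$ is the set of $d_1X_7+d_2X_8+d_3X_9$ with $d_2\pm d_3\ge 0$, $d_1\pm d_3\ge0$, $d_1\pm d_2\ge0$. \textbf{Simulation.} $H$ (infinitesimally) simulates $H'$ in time $t$ if there are $m\in\mathbb N\cup\{0,\infty\}$, local unitary operators $U_j$ ($0\le j\le m$) and times $t_j\ge0$ ($1\le j\le m$) with $\sum_{j=1}^m t_j=t$ such that $\prod_{j=0}^mU_j=\mathrm{id}$ and $$\lim_{s\to0,\,s>0}\frac{d}{ds}e^{-isH'}=\lim_{s\to0,\,s>0}\frac{d}{ds}\Bigl\{\Bigl[\prod_{j=1}^mU_je^{-isHt_j}\Bigr]U_0\Bigr\}.$$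 Here factors with larger index stand further to the left, and for $m=\infty$ a product is the limit of its partial products. \textbf{$s$-majorization.} For $x\in\mathbb R^3$ let $\hat x^{\downarrow}$ be the vector of the $|x_i|$ in decreasing order, and put $x^{\downarrow_s}=(\hat x^\downarrow_1,\hat x^\downarrow_2,\mathrm{sgn}(x_1x_2x_3)\,\hat x^\downarrow_3)$. Write $x\prec_s y$ if $x^{\downarrow_s}_1\le y^{\downarrow_s}_1$, $x^{\downarrow_s}_1+x^{\downarrow_s}_2+x^{\downarrow_s}_3\le y^{\downarrow_s}_1+y^{\downarrow_s}_2+y^{\downarrow_s}_3$ and $x^{\downarrow_s}_1+x^{\downarrow_s}_2-x^{\downarrow_s}_3\le y^{\downarrow_s}_1+y^{\downarrow_s}_2-y^{\downarrow_s}_3$. \textbf{Theorem.} Let $H,H'$ be non-local two-qubit Hamilton operators, let $L,L'$ be local unitary operators and $\vec a=(a_1,a_2,a_3)$, $\vec a'=(a'_1,a'_2,a'_3)\in\mathbb R^3$ with $a_1X_7+a_2X_8+a_3X_9=L^{-1}(iH)L$ and $a'_1X_7+a'_2X_8+a'_3X_9=L'^{-1}(iH')L'$. (1) If both of these elements of $\mathfrak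 a$ lie in the closed fundamental Weyl chamber, then for every $t>0$: $H$ simulates $H'$ in time $t$ if and only if $$a_1\ge a'_1/t,\qquad a_1+a_2+a_3\ge(a'_1+a'_2+a'_3)/t,\qquad a_1+a_2-a_3\ge(a'_1+a'_2-a'_3)/t.$$ (2) Without the Weyl chamber assumption, for every $t\ge0$: $H$ simulates $H'$ in time $t$ if and only if $\vec a'\prec_s t\,\vec a$. -/

import Mathlib

open Matrix Filter Topology
open scoped Kronecker

namespace TwoQubit

/-- Operators on `ℂ² ⊗ ℂ²`; the index pairs label the product basis. -/
abbrev Op : Type := Matrix (Fin 2 × Fin 2) (Fin 2 × Fin 2) ℂ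

/-- The Pauli matrices `σ_x, σ_y, σ_z`. -/
def pauli : Fin 3 → Matrix (Fin 2) (Fin 2) ℂ :=
  ![!![0, 1; 1, 0], !![0, -Complex.I; Complex.I, 0], !![1, 0; 0, -1]]

/-- The basis element `(i/2) σ_j ⊗ σ_k` of the non-local part of `𝔰𝔲(4)`. -/
noncomputable def couplingBasis (j k : Fin 3) : Op :=
  (Complex.I / 2) • (pauli j ⊗ₖ pauli k)

/-- The real subspace `𝔭` of `𝔰𝔲(4)`, spanned by the nine elements `(i/2) σ_j ⊗ σ_k`. -/
noncomputable def nonlocalSpace : Submodule ℝ Op :=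
  Submodule.span ℝ (Set.range fun jk : Fin 3 × Fin 3 => couplingBasis jk.1 jk.2)

/-- A non-local Hamilton operator, i.e. one without local terms: `i H ∈ 𝔭`. -/
def IsNonlocalHamiltonian (H : Op) : Prop :=
  Complex.I • H ∈ nonlocalSpace

/-- The element `c₁ (i/2) σ_x ⊗ σ_x + c₂ (i/2) σ_y ⊗ σ_y + c₃ (i/2) σ_z ⊗ σ_z` of the
maximal Abelian subalgebra `𝔞 ⊆ 𝔭`; every element of `𝔞` has this form for a unique `c`. -/
noncomputable def cartan (c : Fin 3 → ℝ) : Op :=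
  ∑ j, c j • couplingBasis j j

/-- The local unitary operators `A ⊗ B` with `A, B ∈ SU(2)`. -/
def localUnitaries : Set Op :=
  {L | ∃ A ∈ specialUnitaryGroup (Fin 2) ℂ, ∃ B ∈ specialUnitaryGroup (Fin 2) ℂ, L = A ⊗ₖ B}

/-- The adjoint action, in the convention `Ad(L)(X) = L⁻¹ X L`. -/
noncomputable def Ad (L X : Op) : Op := L⁻¹ * X * L

/-- The closed fundamental Weyl chamber of `𝔞`, in coordinates. -/
def closedFundamentalWeylChamber : Set (Fin 3 → ℝ) :=
  {d | 0 ≤ d 1 - d 2 ∧ 0 ≤ d 1 + d 2 ∧ 0 ≤ d 0 - d 2 ∧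
       0 ≤ d 0 + d 2 ∧ 0 ≤ d 0 + d 1 ∧ 0 ≤ d 0 - d 1}

/-! ### Infinitesimal Hamiltonian simulation -/

/-- `orderedProd V e n = V (e + n - 1) ⋯ V (e + 1) V e`: the product of `n` factors starting with
index `e`, where factors with larger index stand further to the left. -/
def orderedProd (V : ℕ → Op) (e : ℕ) : ℕ → Op
  | 0 => 1
  | n + 1 => V (e + n) * orderedProd V e n

/-- `P` is the value of the ordered product of `m` factors `V e, V (e + 1), …`; a product with
infinitely many factors is the limit of its partial products. -/
def IsOrderedProd (V : ℕ → Op) (e : ℕ) (m : ℕ∞) (P : Op) : Prop :=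
  (∀ n : ℕ, m = n → P = orderedProd V e n) ∧
  (m = ⊤ → Tendsto (fun n => orderedProd V e n) atTop (𝓝 P))

/-- `t = ∑_{j=1}^m τ j`, where `m` may be infinite. -/
def IsTotalTime (τ : ℕ → ℝ) (m : ℕ∞) (t : ℝ) : Prop :=
  (∀ n : ℕ, m = n → t = ∑ j ∈ Finset.Icc 1 n, τ j) ∧
  (m = ⊤ → HasSum (fun j : ℕ => τ (j + 1)) t)

/-- The evolution operator `exp(-i H s)`. -/
noncomputable def evolution (H : Op) (s : ℝ) : Op :=
  NormedSpace.exp ((-(Complex.I * (s : ℂ))) • H)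

/-- `F` is differentiable at all `s > 0` and `lim_{s → 0, s > 0} (d/ds) F(s) = D`. -/
def HasLimitDerivAtZero (F : ℝ → Op) (D : Op) : Prop :=
  ∃ F' : ℝ → Op, (∀ s, 0 < s → HasDerivAt F (F' s) s) ∧ Tendsto F' (𝓝[>] 0) (𝓝 D)

/-- The system with Hamilton operator `H` and local unitary operators available simulates `H'`
infinitesimally in time `t`: there are a number `m` of steps (possibly `0` or infinite), local
unitary operators `U j` (`0 ≤ j ≤ m`) and times `τ j ≥ 0` (`1 ≤ j ≤ m`) of sum `t` such that
`∏_{j=0}^m U j = 1`, and `exp(-i s H')` and the program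
`[∏_{j=1}^m U j exp(-i s H τ j)] U 0` have the same limit of derivatives as `s → 0`, `s > 0`.
Values of `U` and `τ` at indices above `m` play no role. -/
def Simulates (H H' : Op) (t : ℝ) : Prop :=
  ∃ (m : ℕ∞) (U : ℕ → Op) (τ : ℕ → ℝ),
    (∀ j, U j ∈ localUnitaries) ∧ (∀ j, 0 ≤ τ j) ∧ IsTotalTime τ m t ∧
    IsOrderedProd U 0 (m + 1) 1 ∧
    ∃ P : ℝ → Op,
      (∀ s, 0 < s → IsOrderedProd (fun j => U j * evolution H (s * τ j)) 1 m (P s)) ∧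
      ∃ D : Op, HasLimitDerivAtZero (fun s => evolution H' s) D ∧
        HasLimitDerivAtZero (fun s => P s * U 0) D

/-! ### `s`-majorization -/

/-- The decreasing rearrangement `x^↓`. -/
noncomputable def decreasing {k : ℕ} (x : Fin k → ℝ) : Fin k → ℝ :=
  x ∘ Tuple.sort (fun i => -x i)

theorem decreasing_antitone {k : ℕ} (x : Fin k → ℝ) : Antitone (decreasing x) := by
  intro i j hij
  have h := Tuple.monotone_sort (fun i => -x i) hij
  simpa [decreasing] using h

/-- The `s`-ordered version of a vector of `ℝ³`: the absolute values in decreasing order, the last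
one multiplied by the sign of `x₁ x₂ x₃`. -/
noncomputable def sOrdered (x : Fin 3 → ℝ) : Fin 3 → ℝ :=
  ![decreasing (fun i => |x i|) 0,
    decreasing (fun i => |x i|) 1,
    Real.sign (x 0 * x 1 * x 2) * decreasing (fun i => |x i|) 2]

/-- `x` is `s`-majorized by `y`. -/
def SMajorized (x y : Fin 3 → ℝ) : Prop :=
  sOrdered x 0 ≤ sOrdered y 0 ∧
  sOrdered x 0 + sOrdered x 1 + sOrdered x 2 ≤ sOrdered y 0 + sOrdered y 1 + sOrdered y 2 ∧
  sOrdered x 0 + sOrdered x 1 - sOrdered x 2 ≤ sOrdered y 0 + sOrdered y 1 - sOrdered y 2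

end TwoQubit

namespace TwoQubit

/-! ### Second-order estimates for products of exponentials -/

section Analysis

variable {𝔸 : Type*} [NormedRing 𝔸] [NormedAlgebra ℝ 𝔸] [CompleteSpace 𝔸]

/-! Absorbing the control operations into a moving frame turns a program into an ordered product of
exponentials of conjugates of `-iH`. Its first-order term shows that simulation in time `t` means
`iH' = ∑ τ j • W j (iH) (W j)⁻¹` with local unitary `W j`, `τ j ≥ 0` and `∑ τ j = t`
(`Simulates.exists_hasSum`, `simulates_of_sum`). Infinite programs are covered because the error
estimate depends only on the total time.

Permutations and even sign changes of the coordinates are realized by local unitaries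
(`locallyConj_of_mem_weylOrbit`), so both Hamiltonians may be moved into the closed Weyl chamber,
where the coordinates are `sOrdered`.

Necessity is a spectral statement. The Bell basis diagonalizes `𝔞`, and conjugation by any unitary
replaces the diagonal by its image under a doubly stochastic matrix. Bounding one diagonal entry by
the largest eigenvalue, one by the smallest, and a sum of two by the two largest gives exactly the
three inequalities (`bellDiag_conj_le`).

Sufficiency is convexity. The inequalities place the target in the convex hull of the Weyl orbit of
`t • c`, by separation and a rearrangement argument (`mem_convexHull_weylOrbit`), and a convex
combination of orbit points is a finite program. -/

theorem norm_exp_sub_one_le (k : 𝔸) : ‖NormedSpace.exp k - 1‖ ≤ Real.exp ‖k‖ - 1 := by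
  have h := (hasSum_nat_add_iff' 1).2 (NormedSpace.exp_series_hasSum_exp' (𝕂 := ℝ) k)
  have h' := (hasSum_nat_add_iff' 1).2 (NormedSpace.exp_series_hasSum_exp' (𝕂 := ℝ) ‖k‖)
  rw [← Real.exp_eq_exp_ℝ] at h'
  simp only [Finset.sum_range_one, pow_zero, Nat.factorial_zero, Nat.cast_one, inv_one, one_smul]
    at h h'
  refine h.norm_le_of_bounded h' fun n => ?_
  rw [norm_smul, smul_eq_mul]
  have : ‖((n + 1).factorial : ℝ)⁻¹‖ = ((n + 1).factorial : ℝ)⁻¹ := by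
    simp
  rw [this]
  gcongr
  exact norm_pow_le' k n.succ_pos

theorem norm_exp_sub_one_sub_le (k : 𝔸) :
    ‖NormedSpace.exp k - 1 - k‖ ≤ Real.exp ‖k‖ - 1 - ‖k‖ := by
  have h := (hasSum_nat_add_iff' 2).2 (NormedSpace.exp_series_hasSum_exp' (𝕂 := ℝ) k)
  have h' := (hasSum_nat_add_iff' 2).2 (NormedSpace.exp_series_hasSum_exp' (𝕂 := ℝ) ‖k‖)
  rw [← Real.exp_eq_exp_ℝ] at h'
  simp only [Finset.sum_range_succ, Finset.sum_range_zero, zero_add, pow_zero, pow_one,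
    Nat.factorial_zero, Nat.factorial_one, Nat.cast_one, inv_one, one_smul, ← sub_sub] at h h'
  refine h.norm_le_of_bounded h' fun n => ?_
  rw [norm_smul, smul_eq_mul]
  have : ‖((n + 2).factorial : ℝ)⁻¹‖ = ((n + 2).factorial : ℝ)⁻¹ := by
    simp
  rw [this]
  gcongr
  exact norm_pow_le' k (Nat.succ_pos _)

/-- An ordered product of exponentials agrees with its linearization up to second order. -/
theorem norm_prod_exp_sub_le {G k : ℕ → 𝔸} {x : ℕ → ℝ} (h0 : G 0 = 1)
    (hG : ∀ n, G (n + 1) = NormedSpace.exp (k n) * G n) (hk : ∀ n, ‖k n‖ ≤ x n) (n : ℕ) :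
    ‖G n - 1‖ ≤ Real.exp (∑ i ∈ Finset.range n, x i) - 1 ∧
    ‖G n - 1 - ∑ i ∈ Finset.range n, k i‖ ≤
      Real.exp (∑ i ∈ Finset.range n, x i) - 1 - ∑ i ∈ Finset.range n, x i := by
  induction n with
  | zero => simp [h0]
  | succ n ih =>
    obtain ⟨ih1, ih2⟩ := ih
    rw [Finset.sum_range_succ, Finset.sum_range_succ, Real.exp_add, hG]
    set X := ∑ i ∈ Finset.range n, x i
    set S := ∑ i ∈ Finset.range n, k i
    have e1 : ‖NormedSpace.exp (k n) - 1‖ ≤ Real.exp (x n) - 1 :=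
      (norm_exp_sub_one_le _).trans (by gcongr; exact hk n)
    -- Uses that `exp r - 1 - r` increases for `r ≥ 0`.
    have e2 : ‖NormedSpace.exp (k n) - 1 - k n‖ ≤ Real.exp (x n) - 1 - x n := by
      refine (norm_exp_sub_one_sub_le _).trans ?_
      have hn := norm_nonneg (k n)
      have h1 := Real.add_one_le_exp (x n - ‖k n‖)
      have h2 : Real.exp (x n) = Real.exp (x n - ‖k n‖) * Real.exp ‖k n‖ := by
        rw [← Real.exp_add]; ring_nf
      have h3 := Real.one_le_exp hn
      nlinarith [hk n]
    have e3 : ‖(NormedSpace.exp (k n) - 1) * (G n - 1)‖ ≤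
        (Real.exp (x n) - 1) * (Real.exp X - 1) :=
      (norm_mul_le _ _).trans (mul_le_mul e1 ih1 (norm_nonneg _) ((norm_nonneg _).trans e1))
    constructor
    · have : NormedSpace.exp (k n) * G n - 1 = (NormedSpace.exp (k n) - 1) * (G n - 1)
          + (NormedSpace.exp (k n) - 1) + (G n - 1) := by noncomm_ring
      rw [this]
      refine (norm_add₃_le).trans ?_
      nlinarith
    · have : NormedSpace.exp (k n) * G n - 1 - (S + k n) =
          (NormedSpace.exp (k n) - 1) * (G n - 1)
          + (NormedSpace.exp (k n) - 1 - k n) + (G n - 1 - S) := by noncomm_ring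
      rw [this]
      refine (norm_add₃_le).trans ?_
      nlinarith

end Analysis

/-! ### Identifying a limit of derivatives at the right of zero -/

section RightLimit

variable {E : Type*} [NormedAddCommGroup E] [NormedSpace ℝ E]

theorem hasDerivWithinAt_of_norm_sub_le {F : ℝ → E} {S : E} {c : ℝ}
    (h : ∀ s, 0 ≤ s → ‖F s - F 0 - s • S‖ ≤ Real.exp (s * c) - 1 - s * c) :
    HasDerivWithinAt F S (Set.Ici 0) 0 := by
  rw [hasDerivWithinAt_iff_isLittleO]
  have h1 : HasDerivAt (fun s : ℝ => Real.exp (s * c)) c 0 := by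
    simpa using ((hasDerivAt_id (0 : ℝ)).mul_const c).exp
  have h2 := (hasDerivWithinAt_iff_isLittleO.1 (h1.hasDerivWithinAt (s := Set.Ici 0)))
  refine (Asymptotics.IsBigO.of_bound 1 ?_).trans_isLittleO h2
  filter_upwards [self_mem_nhdsWithin] with s hs
  have := h s hs
  simp only [sub_zero, zero_mul, Real.exp_zero, smul_eq_mul, one_mul]
  exact this.trans (le_abs_self _)

/-- A program is constrained only for `s > 0`, so `F 0` is meaningless and is overwritten by `F₀`.
The modified function then has right derivative `S` at zero by the estimate and `D` by the limit of
derivatives, and right derivatives are unique. -/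
theorem eq_of_tendsto_deriv_of_norm_sub_le {F F' : ℝ → E} {F₀ D S : E} {c : ℝ}
    (hF : ∀ s, 0 < s → HasDerivAt F (F' s) s) (hD : Tendsto F' (𝓝[>] 0) (𝓝 D))
    (h : ∀ s, 0 < s → ‖F s - F₀ - s • S‖ ≤ Real.exp (s * c) - 1 - s * c) : D = S := by
  set f : ℝ → E := Function.update F 0 F₀
  have hf0 : f 0 = F₀ := by simp [f]
  have hf : ∀ s, 0 < s → f s = F s := fun s hs => by simp [f, hs.ne']
  have hfd : ∀ s, 0 < s → HasDerivAt f (F' s) s := fun s hs =>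
    (hF s hs).congr_of_eventuallyEq ((lt_mem_nhds hs).mono fun r hr => hf r hr)
  have h1 : HasDerivWithinAt f S (Set.Ici 0) 0 := by
    refine hasDerivWithinAt_of_norm_sub_le (c := c) fun s hs => ?_
    rcases hs.eq_or_lt with rfl | hs
    · simp
    · rw [hf s hs, hf0]
      exact h s hs
  have h2 : HasDerivWithinAt f D (Set.Ici 0) 0 := by
    refine hasDerivWithinAt_Ici_of_tendsto_deriv (s := Set.Ioi 0)
      (fun s hs => (hfd s hs).differentiableAt.differentiableWithinAt)
      (h1.continuousWithinAt.mono Set.Ioi_subset_Ici_self) self_mem_nhdsWithin ?_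
    refine hD.congr' ?_
    filter_upwards [self_mem_nhdsWithin] with s hs
    exact (hfd s hs).deriv.symm
  exact (uniqueDiffWithinAt_Ici (0 : ℝ)).eq_deriv _ h2 h1

end RightLimit

end TwoQubit

namespace TwoQubit

/-! ### The group of local unitary operators -/

section LocalUnitaries

theorem one_mem_localUnitaries : (1 : Op) ∈ localUnitaries :=
  ⟨1, one_mem _, 1, one_mem _, by simp⟩

theorem mul_mem_localUnitaries {U V : Op} (hU : U ∈ localUnitaries) (hV : V ∈ localUnitaries) :
    U * V ∈ localUnitaries := by
  obtain ⟨A, hA, B, hB, rfl⟩ := hU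
  obtain ⟨C, hC, D, hD, rfl⟩ := hV
  exact ⟨A * C, mul_mem hA hC, B * D, mul_mem hB hD, by rw [mul_kronecker_mul]⟩

theorem localUnitaries_subset_unitary {U : Op} (hU : U ∈ localUnitaries) : U ∈ unitary Op := by
  obtain ⟨A, hA, B, hB, rfl⟩ := hU
  exact kronecker_mem_unitary (mem_specialUnitaryGroup_iff.1 hA).1
    (mem_specialUnitaryGroup_iff.1 hB).1

theorem star_mul_self_of_mem {U : Op} (hU : U ∈ localUnitaries) : star U * U = 1 :=
  Unitary.star_mul_self_of_mem (localUnitaries_subset_unitary hU)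

theorem inv_eq_star {U : Op} (hU : U ∈ localUnitaries) : U⁻¹ = star U :=
  inv_eq_left_inv (star_mul_self_of_mem hU)

theorem isUnit_of_mem {U : Op} (hU : U ∈ localUnitaries) : IsUnit U :=
  ⟨⟨U, star U, Unitary.mul_star_self_of_mem (localUnitaries_subset_unitary hU),
    star_mul_self_of_mem hU⟩, rfl⟩

theorem inv_mul_self {U : Op} (hU : U ∈ localUnitaries) : U⁻¹ * U = 1 :=
  nonsing_inv_mul U ((isUnit_iff_isUnit_det U).1 (isUnit_of_mem hU))

theorem mul_inv_self {U : Op} (hU : U ∈ localUnitaries) : U * U⁻¹ = 1 :=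
  mul_nonsing_inv U ((isUnit_iff_isUnit_det U).1 (isUnit_of_mem hU))

theorem inv_inv_self {U : Op} (hU : U ∈ localUnitaries) : U⁻¹⁻¹ = U :=
  nonsing_inv_nonsing_inv U ((isUnit_iff_isUnit_det U).1 (isUnit_of_mem hU))

theorem inv_mem_localUnitaries {U : Op} (hU : U ∈ localUnitaries) : U⁻¹ ∈ localUnitaries := by
  rw [inv_eq_star hU]
  obtain ⟨A, hA, B, hB, rfl⟩ := hU
  refine ⟨star A, (star (⟨A, hA⟩ : specialUnitaryGroup (Fin 2) ℂ)).2, star B,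
    (star (⟨B, hB⟩ : specialUnitaryGroup (Fin 2) ℂ)).2, ?_⟩
  simp only [star_eq_conjTranspose, conjTranspose_kronecker]

theorem orderedProd_mem {U : ℕ → Op} (hU : ∀ j, U j ∈ localUnitaries) (e n : ℕ) :
    orderedProd U e n ∈ localUnitaries := by
  induction n with
  | zero => exact one_mem_localUnitaries
  | succ n ih => exact mul_mem_localUnitaries (hU _) ih

end LocalUnitaries

/-! ### Simulation as a mixture of local conjugates -/

open scoped Matrix.Norms.L2Operator

theorem norm_inv_conj {U : Op} (hU : U ∈ localUnitaries) (X : Op) : ‖U⁻¹ * X * U‖ = ‖X‖ := by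
  have h := localUnitaries_subset_unitary hU
  rw [inv_eq_star hU, CStarRing.norm_mul_mem_unitary _ h,
    CStarRing.norm_mem_unitary_mul _ (Unitary.star_mem h)]

theorem evolution_eq (H : Op) (s : ℝ) :
    evolution H s = NormedSpace.exp (s • -(Complex.I • H)) := by
  rw [evolution]
  congr 1
  rw [smul_neg, ← Complex.coe_smul s, smul_smul, neg_smul, mul_comm]

/-- The evolution seen in the frame given by the product of the control operations. -/
noncomputable def framed (H : Op) (U : ℕ → Op) (τ : ℕ → ℝ) (s : ℝ) (n : ℕ) : Op :=
  (orderedProd U 0 (n + 1))⁻¹ *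
    (orderedProd (fun j => U j * evolution H (s * τ j)) 1 n * U 0)

/-- The generator of the `n`-th factor of `framed`. -/
noncomputable def framedGen (H : Op) (U : ℕ → Op) (n : ℕ) : Op :=
  -((orderedProd U 0 (n + 1))⁻¹ * (Complex.I • H) * orderedProd U 0 (n + 1))

theorem norm_framedGen {H : Op} {U : ℕ → Op} (hU : ∀ j, U j ∈ localUnitaries) (n : ℕ) :
    ‖framedGen H U n‖ = ‖Complex.I • H‖ := by
  rw [framedGen, norm_neg, norm_inv_conj (orderedProd_mem hU _ _)]

theorem framed_zero {H : Op} {U : ℕ → Op} (hU : ∀ j, U j ∈ localUnitaries) (τ : ℕ → ℝ) (s : ℝ) :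
    framed H U τ s 0 = 1 := by
  simp [framed, orderedProd, inv_mul_self (hU 0)]

/-- The evolution of duration `τ (n + 1)` acts before `U (n + 1)`, so it is conjugated by the frame
`U n ⋯ U 0`; `U (n + 1)` itself cancels against the new frame. -/
theorem framed_succ {H : Op} {U : ℕ → Op} (hU : ∀ j, U j ∈ localUnitaries) (τ : ℕ → ℝ) (s : ℝ)
    (n : ℕ) : framed H U τ s (n + 1) =
      NormedSpace.exp ((s * τ (n + 1)) • framedGen H U n) * framed H U τ s n := by
  have hQ := orderedProd_mem hU 0 (n + 1)
  have hexp : NormedSpace.exp ((s * τ (n + 1)) • framedGen H U n) =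
      (orderedProd U 0 (n + 1))⁻¹ * evolution H (s * τ (n + 1)) * orderedProd U 0 (n + 1) := by
    rw [evolution_eq, ← exp_conj' _ _ (isUnit_of_mem hQ), framedGen]
    congr 1
    simp only [smul_neg, mul_neg, neg_mul, mul_smul_comm, smul_mul_assoc]
  have h1 : orderedProd U 0 (n + 1 + 1) = U (n + 1) * orderedProd U 0 (n + 1) := by
    simp [orderedProd]
  have h2 : orderedProd (fun j => U j * evolution H (s * τ j)) 1 (n + 1) =
      U (n + 1) * evolution H (s * τ (n + 1)) *
        orderedProd (fun j => U j * evolution H (s * τ j)) 1 n := by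
    simp [orderedProd, add_comm]
  rw [hexp, framed, framed, h1, h2, Matrix.mul_inv_rev]
  set Q := orderedProd U 0 (n + 1)
  set P := orderedProd (fun j => U j * evolution H (s * τ j)) 1 n
  calc Q⁻¹ * (U (n + 1))⁻¹ * (U (n + 1) * evolution H (s * τ (n + 1)) * P * U 0)
      = Q⁻¹ * ((U (n + 1))⁻¹ * U (n + 1)) * evolution H (s * τ (n + 1)) * 1 * (P * U 0) := by
        simp only [mul_assoc, one_mul]
    _ = _ := by
        rw [← mul_inv_self hQ, inv_mul_self (hU _)]
        simp only [mul_assoc, one_mul]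

/-- The operator norm is invariant under unitary conjugation, so the error involves the controls
only through the elapsed time. This uniformity allows passage to infinitely many steps. -/
theorem norm_framed_sub_le {H : Op} {U : ℕ → Op} (hU : ∀ j, U j ∈ localUnitaries) {τ : ℕ → ℝ}
    (hτ : ∀ j, 0 ≤ τ j) {s : ℝ} (hs : 0 ≤ s) (n : ℕ) :
    ‖framed H U τ s n - 1 - s • ∑ i ∈ Finset.range n, τ (i + 1) • framedGen H U i‖ ≤
      Real.exp (s * ((∑ i ∈ Finset.range n, τ (i + 1)) * ‖Complex.I • H‖)) - 1 -
        s * ((∑ i ∈ Finset.range n, τ (i + 1)) * ‖Complex.I • H‖) := by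
  have h := (norm_prod_exp_sub_le (G := framed H U τ s)
    (k := fun n => (s * τ (n + 1)) • framedGen H U n)
    (x := fun n => s * (τ (n + 1) * ‖Complex.I • H‖)) (framed_zero hU τ s) (framed_succ hU τ s)
    (fun n => by
      rw [norm_smul, norm_framedGen hU, Real.norm_of_nonneg (mul_nonneg hs (hτ _)), mul_assoc])
    n).2
  simpa only [← Finset.mul_sum, ← Finset.sum_mul, mul_smul, ← Finset.smul_sum] using h

theorem norm_evolution_sub_le (H : Op) {s : ℝ} (hs : 0 ≤ s) :
    ‖evolution H s - 1 - s • -(Complex.I • H)‖ ≤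
      Real.exp (s * ‖Complex.I • H‖) - 1 - s * ‖Complex.I • H‖ := by
  have h := norm_exp_sub_one_sub_le (s • -(Complex.I • H))
  rwa [norm_smul, norm_neg, Real.norm_of_nonneg hs, ← evolution_eq] at h

theorem HasLimitDerivAtZero.eq {F : ℝ → Op} {F₀ D S : Op} {c : ℝ} (hF : HasLimitDerivAtZero F D)
    (h : ∀ s, 0 < s → ‖F s - F₀ - s • S‖ ≤ Real.exp (s * c) - 1 - s * c) : D = S := by
  obtain ⟨F', h1, h2⟩ := hF
  exact eq_of_tendsto_deriv_of_norm_sub_le h1 h2 h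

/-- A simulated Hamiltonian is a mixture of local conjugates of the simulating one. -/
theorem Simulates.exists_hasSum {H H' : Op} {t : ℝ} (h : Simulates H H' t) :
    ∃ (τ : ℕ → ℝ) (W : ℕ → Op), (∀ j, 0 ≤ τ j) ∧ (∀ j, W j ∈ localUnitaries) ∧ HasSum τ t ∧
      HasSum (fun j => τ j • (W j * (Complex.I • H) * (W j)⁻¹)) (Complex.I • H') := by
  obtain ⟨m, U, τ, hU, hτ, ht, hQ, P, hP, D, hD', hD⟩ := h
  have hDH : D = -(Complex.I • H') := hD'.eq fun s hs => norm_evolution_sub_le H' hs.le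
  have hW : ∀ j, (orderedProd U 0 (j + 1))⁻¹ ∈ localUnitaries := fun j =>
    inv_mem_localUnitaries (orderedProd_mem hU _ _)
  have hgen : ∀ j, (orderedProd U 0 (j + 1))⁻¹ * (Complex.I • H) *
      (orderedProd U 0 (j + 1))⁻¹⁻¹ = -framedGen H U j := fun j => by
    rw [inv_inv_self (orderedProd_mem hU _ _), framedGen, neg_neg]
  induction m using ENat.recTopCoe with
  | top =>
    have hsum : Summable fun j => τ (j + 1) • framedGen H U j := by
      refine Summable.of_norm_bounded ((ht.2 rfl).summable.mul_right ‖Complex.I • H‖) fun j => ?_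
      rw [norm_smul, norm_framedGen hU, Real.norm_of_nonneg (hτ _)]
    refine ⟨fun j => τ (j + 1), fun j => (orderedProd U 0 (j + 1))⁻¹, fun j => hτ _, hW,
      ht.2 rfl, ?_⟩
    simp only [hgen, smul_neg]
    rw [← neg_neg (Complex.I • H'), ← hDH]
    suffices hS : D = ∑' j, τ (j + 1) • framedGen H U j by
      rw [hS]; exact hsum.hasSum.neg
    refine hD.eq (F₀ := 1) (c := t * ‖Complex.I • H‖) fun s hs => ?_
    -- The controls multiply to the identity, so the frame disappears in the limit and `framed`
    -- converges to the program itself.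
    have hQ1 : Tendsto (fun n => (orderedProd U 0 (n + 1))⁻¹) atTop (𝓝 1) := by
      have := (tendsto_add_atTop_iff_nat 1).2 (hQ.2 rfl)
      have := this.star
      rw [star_one] at this
      exact this.congr fun n => (inv_eq_star (orderedProd_mem hU _ _)).symm
    have hfr : Tendsto (framed H U τ s) atTop (𝓝 (P s * U 0)) := by
      have := hQ1.mul (((hP s hs).2 rfl).mul_const (U 0))
      rwa [one_mul] at this
    have hτs := (ht.2 rfl).tendsto_sum_nat
    have hx := (hτs.mul_const ‖Complex.I • H‖).const_mul s
    exact le_of_tendsto_of_tendsto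
      (((hfr.sub_const 1).sub (hsum.hasSum.tendsto_sum_nat.const_smul s)).norm)
      (((Real.continuous_exp.tendsto _).comp hx |>.sub_const 1).sub hx)
      (Eventually.of_forall fun n => norm_framed_sub_le hU hτ hs.le n)
  | coe n =>
    have hQn : orderedProd U 0 (n + 1) = 1 := (hQ.1 (n + 1) (by push_cast; rfl)).symm
    have hDS : D = ∑ i ∈ Finset.range n, τ (i + 1) • framedGen H U i := by
      refine hD.eq (F₀ := 1)
        (c := (∑ i ∈ Finset.range n, τ (i + 1)) * ‖Complex.I • H‖) fun s hs => ?_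
      have hfr : P s * U 0 = framed H U τ s n := by
        rw [framed, hQn, inv_one, one_mul, (hP s hs).1 n rfl]
      rw [hfr]
      exact norm_framed_sub_le hU hτ hs.le n
    -- A finite program is padded by zero times to fit the series form.
    refine ⟨fun j => if j < n then τ (j + 1) else 0, fun j => (orderedProd U 0 (j + 1))⁻¹,
      fun j => by dsimp only; split_ifs <;> simp [hτ], hW, ?_, ?_⟩
    · have h1 : t = ∑ j ∈ Finset.range n, if j < n then τ (j + 1) else 0 := by
        rw [ht.1 n rfl, ← Finset.sum_filter, Finset.filter_true_of_mem (by simp),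
          Finset.sum_bij' (fun j _ => j - 1) (fun j _ => j + 1)] <;> simp <;> grind
      rw [h1]
      exact hasSum_sum_of_ne_finset_zero fun j hj => if_neg (by simpa using hj)
    · have h1 : Complex.I • H' = ∑ j ∈ Finset.range n, (if j < n then τ (j + 1) else 0) •
          ((orderedProd U 0 (j + 1))⁻¹ * (Complex.I • H) * (orderedProd U 0 (j + 1))⁻¹⁻¹) := by
        rw [← neg_neg (Complex.I • H'), ← hDH, hDS, ← Finset.sum_neg_distrib]
        refine Finset.sum_congr rfl fun j hj => ?_
        rw [if_pos (Finset.mem_range.1 hj), hgen, smul_neg]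
      rw [h1]
      exact hasSum_sum_of_ne_finset_zero fun j hj => by
        dsimp only
        rw [if_neg (by simpa using hj), zero_smul]

/-- `F` has a continuous derivative. -/
def HasContDeriv (F : ℝ → Op) : Prop :=
  ∃ F' : ℝ → Op, (∀ s, HasDerivAt F (F' s) s) ∧ Continuous F'

theorem HasContDeriv.continuous {F : ℝ → Op} (h : HasContDeriv F) : Continuous F := by
  obtain ⟨F', h, -⟩ := h
  exact continuous_iff_continuousAt.2 fun s => (h s).continuousAt

theorem hasContDeriv_const (C : Op) : HasContDeriv fun _ => C :=
  ⟨fun _ => 0, fun _ => hasDerivAt_const _ _, continuous_const⟩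

theorem HasContDeriv.mul {F G : ℝ → Op} (hF : HasContDeriv F) (hG : HasContDeriv G) :
    HasContDeriv fun s => F s * G s := by
  have cF := hF.continuous
  have cG := hG.continuous
  obtain ⟨F', hF, cF'⟩ := hF
  obtain ⟨G', hG, cG'⟩ := hG
  exact ⟨fun s => F' s * G s + F s * G' s, fun s => (hF s).mul (hG s),
    (cF'.mul cG).add (cF.mul cG')⟩

theorem hasContDeriv_evolution (H : Op) (r : ℝ) : HasContDeriv fun s => evolution H (s * r) := by
  refine ⟨fun s => NormedSpace.exp (s • (r • -(Complex.I • H))) * (r • -(Complex.I • H)),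
    fun s => ?_, ?_⟩
  · simp only [evolution_eq, mul_smul]
    exact hasDerivAt_exp_smul_const (𝕂 := ℝ) (r • -(Complex.I • H)) s
  · exact (continuous_iff_continuousAt.2 fun s => (hasDerivAt_exp_smul_const (𝕂 := ℝ)
      (r • -(Complex.I • H)) s).continuousAt).mul continuous_const

theorem hasContDeriv_orderedProd {V : ℝ → ℕ → Op} (hV : ∀ j, HasContDeriv fun s => V s j)
    (e n : ℕ) : HasContDeriv fun s => orderedProd (V s) e n := by
  induction n with
  | zero => exact hasContDeriv_const 1
  | succ n ih => exact (hV (e + n)).mul ih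

theorem HasContDeriv.hasLimitDerivAtZero {F : ℝ → Op} (hF : HasContDeriv F) {S : Op} {c : ℝ}
    (h : ∀ s, 0 ≤ s → ‖F s - 1 - s • S‖ ≤ Real.exp (s * c) - 1 - s * c) :
    HasLimitDerivAtZero F S := by
  obtain ⟨F', h1, h2⟩ := hF
  -- At `s = 0` the right-hand side of the estimate vanishes.
  have h0 : F 0 = 1 := by simpa [sub_eq_zero] using h 0 le_rfl
  have h3 : HasDerivWithinAt F S (Set.Ici 0) 0 :=
    hasDerivWithinAt_of_norm_sub_le (c := c) (by rwa [h0])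
  have h4 : F' 0 = S := (uniqueDiffWithinAt_Ici (0 : ℝ)).eq_deriv _ (h1 0).hasDerivWithinAt h3
  refine ⟨F', fun s _ => h1 s, ?_⟩
  rw [← h4]
  exact h2.continuousAt.mono_left nhdsWithin_le_nhds

/-- Finite mixtures of local conjugates of a Hamiltonian can be simulated. -/
theorem simulates_of_sum {H H' : Op} {t : ℝ} {n : ℕ} {τ : ℕ → ℝ} {W : ℕ → Op}
    (hτ : ∀ j, 0 ≤ τ j) (hW : ∀ j, W j ∈ localUnitaries)
    (ht : t = ∑ j ∈ Finset.range n, τ j)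
    (hH : Complex.I • H' = ∑ j ∈ Finset.range n, τ j • (W j * (Complex.I • H) * (W j)⁻¹)) :
    Simulates H H' t := by
  -- The frames are prescribed first and the controls recovered as successive quotients. The value
  -- `1` at index `n` closes the product of all controls.
  set Q : ℕ → Op := fun i => if i < n then (W i)⁻¹ else 1 with hQdef
  have hQ : ∀ i, Q i ∈ localUnitaries := fun i => by
    simp only [hQdef]
    split_ifs
    exacts [inv_mem_localUnitaries (hW i), one_mem_localUnitaries]
  set U : ℕ → Op := fun i => Nat.rec (Q 0) (fun i _ => Q (i + 1) * (Q i)⁻¹) i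
  have hU0 : U 0 = Q 0 := rfl
  have hU1 : ∀ i, U (i + 1) = Q (i + 1) * (Q i)⁻¹ := fun i => rfl
  have hU : ∀ i, U i ∈ localUnitaries := by
    rintro (_ | i)
    exacts [hQ 0, mul_mem_localUnitaries (hQ _) (inv_mem_localUnitaries (hQ _))]
  have hprod : ∀ i, orderedProd U 0 (i + 1) = Q i := fun i => by
    induction i with
    | zero => simp [orderedProd, hU0]
    | succ i ih =>
      rw [orderedProd, ih, zero_add, hU1, mul_assoc, inv_mul_self (hQ i), mul_one]
  have hQn : Q n = 1 := by simp [hQdef]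
  have hgen : ∑ i ∈ Finset.range n, τ i • framedGen H U i = -(Complex.I • H') := by
    rw [hH, ← Finset.sum_neg_distrib]
    refine Finset.sum_congr rfl fun i hi => ?_
    rw [framedGen, hprod, smul_neg]
    simp only [hQdef, if_pos (Finset.mem_range.1 hi), inv_inv_self (hW i)]
  -- Program times are numbered from `1` and mixture weights from `0`, hence the shift; the time at
  -- index `0` is never used.
  refine ⟨n, U, fun j => τ (j - 1), hU, fun j => hτ _, ⟨fun k hk => ?_, by simp⟩,
    ⟨fun k hk => ?_, ?_⟩, fun s => orderedProd (fun j => U j * evolution H (s * τ (j - 1))) 1 n,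
    fun s _ => ⟨fun k hk => ?_, by simp⟩, -(Complex.I • H'), ?_, ?_⟩
  · obtain rfl : n = k := by exact_mod_cast hk
    rw [ht, Finset.sum_bij' (fun j _ => j + 1) (fun j _ => j - 1)] <;> simp <;> grind
  · obtain rfl : n + 1 = k := by exact_mod_cast hk
    rw [hprod, hQn]
  · intro hk
    exact absurd hk (by exact_mod_cast ENat.natCast_ne_top (n + 1))
  · obtain rfl : n = k := by exact_mod_cast hk
    rfl
  · have := hasContDeriv_evolution H' 1
    simp only [mul_one] at this
    exact this.hasLimitDerivAtZero fun s hs => norm_evolution_sub_le H' hs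
  · refine HasContDeriv.hasLimitDerivAtZero ((hasContDeriv_orderedProd (fun j =>
      (hasContDeriv_const (U j)).mul (hasContDeriv_evolution H (τ (j - 1)))) 1 n).mul
      (hasContDeriv_const (U 0))) (c := t * ‖Complex.I • H‖) fun s hs => ?_
    have h := norm_framed_sub_le (H := H) hU (τ := fun j => τ (j - 1)) (fun j => hτ _) hs n
    simp only [Nat.add_sub_cancel] at h
    rwa [hgen, ← ht, framed, hprod, hQn, inv_one, one_mul] at h

end TwoQubit

namespace TwoQubit

/-! ### The Weyl group of `𝔞` -/

/-- The orbit of `c` under permutations and even numbers of sign changes. -/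
def weylOrbit (c : Fin 3 → ℝ) : Set (Fin 3 → ℝ) :=
  {d | ∃ (σ : Equiv.Perm (Fin 3)) (ε : Fin 3 → ℤˣ), ∏ i, ε i = 1 ∧
    d = fun i => ((ε i : ℤ) : ℝ) * c (σ i)}

theorem finite_weylOrbit (c : Fin 3 → ℝ) : (weylOrbit c).Finite := by
  refine (Set.finite_range fun p : Equiv.Perm (Fin 3) × (Fin 3 → ℤˣ) =>
    fun i => ((p.2 i : ℤ) : ℝ) * c (p.1 i)).subset ?_
  rintro _ ⟨σ, ε, -, rfl⟩
  exact ⟨(σ, ε), rfl⟩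

/-- Ties do not affect the sorted vector, so any sorting permutation may replace the chosen one. -/
theorem decreasing_eq_comp {k : ℕ} {x : Fin k → ℝ} {σ : Equiv.Perm (Fin k)}
    (h : Antitone (x ∘ σ)) : decreasing x = x ∘ σ := by
  have h1 : Monotone ((fun i => -x i) ∘ σ) := fun i j hij => neg_le_neg (h hij)
  have h2 := (Tuple.comp_sort_eq_comp_iff_monotone (f := fun i => -x i)).2 h1
  funext i
  simpa [decreasing] using (congr_fun h2 i).symm

theorem sOrdered_eq {x : Fin 3 → ℝ} {σ : Equiv.Perm (Fin 3)}
    (h : Antitone ((fun i => |x i|) ∘ σ)) :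
    sOrdered x = ![|x (σ 0)|, |x (σ 1)|, Real.sign (x 0 * x 1 * x 2) * |x (σ 2)|] := by
  rw [sOrdered, decreasing_eq_comp h]
  rfl

theorem exists_antitone_abs (x : Fin 3 → ℝ) :
    ∃ σ : Equiv.Perm (Fin 3), Antitone ((fun i => |x i|) ∘ σ) :=
  ⟨_, decreasing_antitone fun i => |x i|⟩

theorem sOrdered_smul {t : ℝ} (ht : 0 ≤ t) (x : Fin 3 → ℝ) :
    sOrdered (t • x) = t • sOrdered x := by
  obtain ⟨σ, hσ⟩ := exists_antitone_abs x
  have hσ' : Antitone ((fun i => |(t • x) i|) ∘ σ) := fun i j hij => by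
    have := hσ hij
    simp only [Function.comp_apply, Pi.smul_apply, smul_eq_mul, abs_mul] at this ⊢
    gcongr
  rw [sOrdered_eq hσ, sOrdered_eq hσ']
  -- The sign factor is preserved only for `t > 0`; at `t = 0` both sides vanish.
  rcases ht.eq_or_lt with rfl | ht
  · ext i
    fin_cases i <;> simp
  · have h1 : Real.sign ((t • x) 0 * (t • x) 1 * (t • x) 2) = Real.sign (x 0 * x 1 * x 2) := by
      have : (t • x) 0 * (t • x) 1 * (t • x) 2 = t ^ 3 * (x 0 * x 1 * x 2) := by
        simp only [Pi.smul_apply, smul_eq_mul]; ring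
      have ht3 : 0 < t ^ 3 := by positivity
      rw [this]
      rcases lt_trichotomy (x 0 * x 1 * x 2) 0 with h | h | h
      · rw [Real.sign_of_neg h, Real.sign_of_neg (mul_neg_of_pos_of_neg ht3 h)]
      · rw [h, mul_zero]
      · rw [Real.sign_of_pos h, Real.sign_of_pos (mul_pos ht3 h)]
    rw [h1]
    ext i
    fin_cases i <;> simp [abs_mul, abs_of_pos ht, mul_left_comm]

theorem sOrdered_eq_self {x : Fin 3 → ℝ} (hx : x ∈ closedFundamentalWeylChamber) :
    sOrdered x = x := by
  obtain ⟨h1, h2, h3, h4, h5, h6⟩ := hx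
  have a0 : |x 0| = x 0 := abs_of_nonneg (by linarith)
  have a1 : |x 1| = x 1 := abs_of_nonneg (by linarith)
  have a2 : |x 2| ≤ x 1 := abs_le.2 ⟨by linarith, by linarith⟩
  have hσ : Antitone ((fun i => |x i|) ∘ (1 : Equiv.Perm (Fin 3))) := by
    intro i j hij
    simp only [Function.comp_apply, Equiv.Perm.coe_one, id_eq]
    have h10 : |x 1| ≤ |x 0| := by rw [a0, a1]; linarith
    have h21 : |x 2| ≤ |x 1| := by rwa [a1]
    fin_cases i <;> fin_cases j <;> first
      | exact absurd hij (by decide)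
      | exact le_rfl
      | exact h10
      | exact h21
      | exact h21.trans h10
  rw [sOrdered_eq hσ]
  have hs : Real.sign (x 0 * x 1 * x 2) * |x 2| = x 2 := by
    rcases eq_or_ne (x 2) 0 with h | h
    · simp [h]
    · have hp : 0 < |x 2| := abs_pos.2 h
      have h01 : 0 < x 0 * x 1 := mul_pos (by linarith) (by linarith)
      rcases h.lt_or_gt with h | h
      · rw [Real.sign_of_neg (mul_neg_of_pos_of_neg h01 h), abs_of_neg h]; ring
      · rw [Real.sign_of_pos (mul_pos h01 h), abs_of_pos h]; ring
  ext i
  fin_cases i <;> simp [a0, a1, hs]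

theorem sOrdered_mem_chamber (x : Fin 3 → ℝ) : sOrdered x ∈ closedFundamentalWeylChamber := by
  obtain ⟨σ, hσ⟩ := exists_antitone_abs x
  have h1 : |x (σ 1)| ≤ |x (σ 0)| := hσ (by decide)
  have h2 : |x (σ 2)| ≤ |x (σ 1)| := hσ (by decide)
  have h0 := abs_nonneg (x (σ 2))
  rw [sOrdered_eq hσ]
  obtain h | h | h := Real.sign_apply_eq (x 0 * x 1 * x 2) <;>
  · simp only [closedFundamentalWeylChamber, Set.mem_ofPred_eq, h, cons_val_zero, cons_val_one,
      cons_val_two, tail_cons, head_cons]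
    refine ⟨?_, ?_, ?_, ?_, ?_, ?_⟩ <;> linarith

theorem exists_unit_mul_abs (r : ℝ) : ∃ e : ℤˣ, r = ((e : ℤ) : ℝ) * |r| := by
  rcases le_total 0 r with h | h
  · exact ⟨1, by simp [abs_of_nonneg h]⟩
  · exact ⟨-1, by simp [abs_of_nonpos h]⟩

theorem mem_weylOrbit_sOrdered (x : Fin 3 → ℝ) : x ∈ weylOrbit (sOrdered x) := by
  obtain ⟨σ, hσ⟩ := exists_antitone_abs x
  have h1 : |x (σ 1)| ≤ |x (σ 0)| := hσ (by decide)
  have h2 : |x (σ 2)| ≤ |x (σ 1)| := hσ (by decide)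
  have hprod : x 0 * x 1 * x 2 = x (σ 0) * x (σ 1) * x (σ 2) := by
    simpa only [Fin.prod_univ_three] using (Equiv.prod_comp σ x).symm
  obtain ⟨e₀, he₀⟩ := exists_unit_mul_abs (x (σ 0))
  obtain ⟨e₁, he₁⟩ := exists_unit_mul_abs (x (σ 1))
  -- The third sign is forced by evenness. It is correct because `sOrdered` gives its last entry the
  -- sign of the whole product; if that entry is zero, any sign works.
  have hδ : ∀ i, x (σ i) = (((![e₀, e₁, e₀ * e₁] i : ℤˣ) : ℤ) : ℝ) * sOrdered x i := by
    rw [sOrdered_eq hσ, hprod]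
    intro i
    fin_cases i
    · simpa using he₀
    · simpa using he₁
    · simp only [Fin.reduceFinMk, cons_val, Units.val_mul, Int.cast_mul]
      rcases eq_or_ne (x (σ 2)) 0 with h | h
      · simp [h]
      · have hp2 : 0 < |x (σ 2)| := abs_pos.2 h
        have hp1 : 0 < |x (σ 1)| := hp2.trans_le h2
        have hp0 : 0 < |x (σ 0)| := hp1.trans_le h1
        rw [he₀, he₁]
        have hpp := mul_pos hp0 hp1
        rcases Int.units_eq_one_or e₀ with rfl | rfl <;>
          rcases Int.units_eq_one_or e₁ with rfl | rfl <;>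
          rcases h.lt_or_gt with h | h <;>
          simp only [Units.val_one, Units.val_neg, Int.cast_one, Int.cast_neg, one_mul, mul_one,
            neg_mul, mul_neg, neg_neg] <;>
          first
          | (rw [Real.sign_of_neg (by nlinarith)]; first
              | (rw [abs_of_neg h]; ring)
              | (rw [abs_of_pos h]; ring))
          | (rw [Real.sign_of_pos (by nlinarith)]; first
              | (rw [abs_of_neg h]; ring)
              | (rw [abs_of_pos h]; ring))
  refine ⟨σ⁻¹, fun i => ![e₀, e₁, e₀ * e₁] (σ⁻¹ i), ?_, ?_⟩
  · rw [Equiv.prod_comp σ⁻¹ (fun i => ![e₀, e₁, e₀ * e₁] i), Fin.prod_univ_three]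
    exact Int.units_mul_self (e₀ * e₁)
  · funext i
    rw [← hδ]
    simp

theorem perm_fin_three_cases (σ : Equiv.Perm (Fin 3)) :
    (σ 0 = 0 ∧ σ 1 = 1 ∧ σ 2 = 2) ∨ (σ 0 = 0 ∧ σ 1 = 2 ∧ σ 2 = 1) ∨
    (σ 0 = 1 ∧ σ 1 = 0 ∧ σ 2 = 2) ∨ (σ 0 = 1 ∧ σ 1 = 2 ∧ σ 2 = 0) ∨
    (σ 0 = 2 ∧ σ 1 = 0 ∧ σ 2 = 1) ∨ (σ 0 = 2 ∧ σ 1 = 1 ∧ σ 2 = 0) := by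
  revert σ
  decide

theorem units_cases {ε : Fin 3 → ℤˣ} (h : ∏ i, ε i = 1) :
    (ε 0 = 1 ∧ ε 1 = 1 ∧ ε 2 = 1) ∨ (ε 0 = 1 ∧ ε 1 = -1 ∧ ε 2 = -1) ∨
    (ε 0 = -1 ∧ ε 1 = 1 ∧ ε 2 = -1) ∨ (ε 0 = -1 ∧ ε 1 = -1 ∧ ε 2 = 1) := by
  rw [Fin.prod_univ_three] at h
  rcases Int.units_eq_one_or (ε 0) with h0 | h0 <;>
    rcases Int.units_eq_one_or (ε 1) with h1 | h1 <;>
    rcases Int.units_eq_one_or (ε 2) with h2 | h2 <;>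
    rw [h0, h1, h2] at h ⊢ <;> revert h <;> decide

/-- Each of these functionals attains its maximum over an orbit at the chamber representative; the
24 group elements are checked one by one. -/
theorem weylOrbit_le {x z : Fin 3 → ℝ} (hx : x ∈ closedFundamentalWeylChamber)
    (hz : z ∈ weylOrbit x) :
    z 0 ≤ x 0 ∧ z 0 + z 1 + z 2 ≤ x 0 + x 1 + x 2 ∧ z 0 + z 1 - z 2 ≤ x 0 + x 1 - x 2 := by
  obtain ⟨σ, ε, hε, rfl⟩ := hz
  obtain ⟨h1, h2, h3, h4, h5, h6⟩ := hx
  rcases perm_fin_three_cases σ with h | h | h | h | h | h <;>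
    rcases units_cases hε with e | e | e | e <;>
    · simp only [h, e, Units.val_one, Units.val_neg, Int.cast_one, Int.cast_neg, one_mul, neg_mul]
      refine ⟨?_, ?_, ?_⟩ <;> linarith

/-- Vectors of the Weyl chamber below `y` lie in the convex hull of the Weyl orbit of `y`. -/
theorem mem_convexHull_weylOrbit {x y : Fin 3 → ℝ} (hx : x ∈ closedFundamentalWeylChamber)
    (h0 : x 0 ≤ y 0) (h1 : x 0 + x 1 + x 2 ≤ y 0 + y 1 + y 2)
    (h2 : x 0 + x 1 - x 2 ≤ y 0 + y 1 - y 2) : x ∈ convexHull ℝ (weylOrbit y) := by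
  by_contra hxy
  obtain ⟨f, u, hu, hfx⟩ := geometric_hahn_banach_closed_point (convex_convexHull ℝ (weylOrbit y))
    ((finite_weylOrbit y).isClosed_convexHull ℝ) hxy
  set g : Fin 3 → ℝ := fun i => f (Pi.single i 1) with hg
  have hf : ∀ z, f z = ∑ i, z i * g i := fun z => by
    have := LinearMap.pi_apply_eq_sum_univ (f : (Fin 3 → ℝ) →ₗ[ℝ] ℝ) z
    simp only [ContinuousLinearMap.coe_coe, smul_eq_mul] at this
    rw [this]
    refine Finset.sum_congr rfl fun i _ => ?_
    rw [hg]
    congr 2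
    funext j
    simp [Pi.single_apply, eq_comm]
  -- The separating functional is moved into the chamber as `G`. The group element is transferred to
  -- the vectors, replacing `x` by an orbit point `z` and selecting the orbit point of `y` on which
  -- `f` takes the value `∑ y i * G i`.
  obtain ⟨σ, ε, hε, hgσ⟩ := mem_weylOrbit_sOrdered g
  obtain ⟨k1, k2, k3, k4, k5, k6⟩ := sOrdered_mem_chamber g
  set G := sOrdered g
  have hsq : ∀ i, ((ε i : ℤ) : ℝ) * ((ε i : ℤ) : ℝ) = 1 := fun i => by
    rcases Int.units_eq_one_or (ε i) with h | h <;> simp [h]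
  set z : Fin 3 → ℝ := fun i => ((ε (σ⁻¹ i) : ℤ) : ℝ) * x (σ⁻¹ i)
  have hz : z ∈ weylOrbit x :=
    ⟨σ⁻¹, fun i => ε (σ⁻¹ i), (Equiv.prod_comp σ⁻¹ ε).trans hε, rfl⟩
  have hfx' : f x = ∑ i, z i * G i := by
    rw [hf, ← Equiv.sum_comp σ fun i => z i * G i]
    refine Finset.sum_congr rfl fun i _ => ?_
    simp only [z, Equiv.Perm.inv_def, Equiv.symm_apply_apply]
    rw [hgσ]
    ring
  have hfy : f (fun i => ((ε i : ℤ) : ℝ) * y (σ i)) = ∑ i, y i * G i := by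
    rw [hf, ← Equiv.sum_comp σ fun i => y i * G i]
    refine Finset.sum_congr rfl fun i _ => ?_
    rw [hgσ]
    linear_combination (y (σ i) * G (σ i)) * hsq i
  have hlt := (hu _ (subset_convexHull ℝ _ ⟨σ, ε, hε, rfl⟩)).trans hfx
  rw [hfx', hfy, Fin.sum_univ_three, Fin.sum_univ_three] at hlt
  obtain ⟨z0, z1, z2⟩ := weylOrbit_le hx hz
  -- Pairing with `G` is `(G 0 - G 1) z 0 + (G 1 + G 2)/2 (z 0 + z 1 + z 2) + (G 1 - G 2)/2 (z 0 + z
  -- 1 - z 2)`, with nonnegative coefficients, so it is no larger at `z` than at `y`.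
  have m0 := mul_nonneg k6 (sub_nonneg.2 (z0.trans h0))
  have m1 := mul_nonneg k2 (sub_nonneg.2 (z1.trans h1))
  have m2 := mul_nonneg k1 (sub_nonneg.2 (z2.trans h2))
  linarith

/-! ### Realization of the Weyl group by local unitary operators -/

/-- Two elements of `𝔞` are conjugate under local unitary operators. -/
def LocallyConj (c d : Fin 3 → ℝ) : Prop :=
  ∃ U ∈ localUnitaries, cartan d = U * cartan c * U⁻¹

theorem LocallyConj.refl (c : Fin 3 → ℝ) : LocallyConj c c :=
  ⟨1, one_mem_localUnitaries, by simp⟩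

theorem LocallyConj.trans {c d e : Fin 3 → ℝ} (h₁ : LocallyConj c d) (h₂ : LocallyConj d e) :
    LocallyConj c e := by
  obtain ⟨U, hU, h₁⟩ := h₁
  obtain ⟨V, hV, h₂⟩ := h₂
  refine ⟨V * U, mul_mem_localUnitaries hV hU, ?_⟩
  rw [h₂, h₁, Matrix.mul_inv_rev]
  simp only [mul_assoc]

/-- When `A` and `B` permute the Pauli matrices in the same way up to sign, `A ⊗ B` preserves `𝔞`
and the two signs multiply. -/
theorem locallyConj_of_pauli {A B : Matrix (Fin 2) (Fin 2) ℂ}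
    (hA : A ∈ specialUnitaryGroup (Fin 2) ℂ) (hB : B ∈ specialUnitaryGroup (Fin 2) ℂ)
    {π : Equiv.Perm (Fin 3)} {r s : Fin 3 → ℝ}
    (hAσ : ∀ k, A * pauli k = (r k : ℂ) • (pauli (π k) * A))
    (hBσ : ∀ k, B * pauli k = (s k : ℂ) • (pauli (π k) * B)) {c d : Fin 3 → ℝ}
    (hd : ∀ k, d (π k) = r k * s k * c k) : LocallyConj c d := by
  have hU : A ⊗ₖ B ∈ localUnitaries := ⟨A, hA, B, hB, rfl⟩
  refine ⟨_, hU, ?_⟩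
  have : A ⊗ₖ B * cartan c = cartan d * A ⊗ₖ B := by
    rw [cartan, cartan, ← Equiv.sum_comp π fun j => d j • couplingBasis j j, Finset.mul_sum, Finset.sum_mul]
    refine Finset.sum_congr rfl fun k _ => ?_
    simp only [couplingBasis, mul_smul_comm, smul_mul_assoc, ← mul_kronecker_mul, hAσ, hBσ,
      smul_kronecker, kronecker_smul, hd, ← Complex.coe_smul, smul_smul]
    congr 1
    push_cast
    ring
  rw [this, mul_assoc, mul_inv_self hU, mul_one]

theorem exists_sqrt_half : ∃ w : ℂ, w * w = 1 / 2 ∧ star w = w := by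
  refine ⟨((√(1 / 2) : ℝ) : ℂ), ?_, Complex.conj_ofReal _⟩
  rw [← Complex.ofReal_mul, Real.mul_self_sqrt (by norm_num)]
  norm_num

theorem I_smul_pauli_mem (k : Fin 3) :
    Complex.I • pauli k ∈ specialUnitaryGroup (Fin 2) ℂ := by
  rw [mem_specialUnitaryGroup_iff, mem_unitaryGroup_iff]
  constructor
  · ext i j
    fin_cases k <;> fin_cases i <;> fin_cases j <;>
      simp [pauli, mul_apply, Fin.sum_univ_two, star_eq_conjTranspose]
  · fin_cases k <;> simp [pauli, det_fin_two]

theorem exists_pauli_swap {i j : Fin 3} (hij : i ≠ j) :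
    ∃ A ∈ specialUnitaryGroup (Fin 2) ℂ, ∀ k, A * pauli k =
      ((if k = i ∨ k = j then 1 else -1 : ℝ) : ℂ) • (pauli (Equiv.swap i j k) * A) := by
  obtain ⟨w, hw, hw'⟩ := exists_sqrt_half
  have hanti : ∀ k l : Fin 3, k ≠ l → pauli k * pauli l = -(pauli l * pauli k) := by
    intro k l hkl
    ext a b
    fin_cases k <;> fin_cases l <;> first
      | exact absurd rfl hkl
      | (fin_cases a <;> fin_cases b <;> simp [pauli, mul_apply, Fin.sum_univ_two])
  have hsq : ∀ k : Fin 3, pauli k * pauli k = 1 := by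
    intro k
    ext a b
    fin_cases k <;> fin_cases a <;> fin_cases b <;> simp [pauli, mul_apply, Fin.sum_univ_two]
  have hstar : ∀ k : Fin 3, star (pauli k) = pauli k := by
    intro k
    ext a b
    fin_cases k <;> fin_cases a <;> fin_cases b <;> simp [pauli]
  -- The half-turn about the bisector of axes `i` and `j`: it exchanges them and reverses the third.
  -- The factor `I` makes the determinant `1`.
  refine ⟨(Complex.I * w) • (pauli i + pauli j), ?_, fun k => ?_⟩
  · rw [mem_specialUnitaryGroup_iff, mem_unitaryGroup_iff]
    constructor
    · have h1 : (pauli i + pauli j) * (pauli i + pauli j) = (2 : ℂ) • 1 := by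
        rw [add_mul, mul_add, mul_add, hsq, hsq, hanti i j hij, two_smul]
        abel
      rw [star_smul, star_add, hstar, hstar, smul_mul_smul_comm, h1, smul_smul, star_mul', hw']
      have h2 : Complex.I * w * (star Complex.I * w) * 2 = 1 := by
        have : star Complex.I = -Complex.I := Complex.conj_I
        rw [this]
        linear_combination (-2 * w * w) * Complex.I_mul_I + 2 * hw
      rw [h2, one_smul]
    · fin_cases i <;> fin_cases j <;> first
        | exact absurd rfl hij
        | (simp [pauli, det_fin_two]; grind [Complex.I_mul_I])
  · have key : (pauli i + pauli j) * pauli k =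
        ((if k = i ∨ k = j then 1 else -1 : ℝ) : ℂ) •
          (pauli (Equiv.swap i j k) * (pauli i + pauli j)) := by
      by_cases hi : k = i
      · subst hi
        simp [add_mul, mul_add, hsq, add_comm]
      · by_cases hj : k = j
        · subst hj
          simp [add_mul, mul_add, hsq, add_comm]
        · rw [Equiv.swap_apply_of_ne_of_ne hi hj, if_neg (by tauto), add_mul, mul_add,
            hanti i k (Ne.symm hi), hanti j k (Ne.symm hj)]
          push_cast
          rw [neg_one_smul, neg_add]
    rw [smul_mul_assoc, key, mul_smul_comm, smul_comm]

theorem locallyConj_comp_perm (σ : Equiv.Perm (Fin 3)) (c : Fin 3 → ℝ) :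
    LocallyConj c (c ∘ σ) := by
  induction σ using Equiv.Perm.swap_induction_on generalizing c with
  | one => exact LocallyConj.refl c
  | swap_mul f x y hxy ih =>
    have h : LocallyConj c (c ∘ Equiv.swap x y) := by
      obtain ⟨A, hA, hAσ⟩ := exists_pauli_swap hxy
      -- Using the same rotation on both qubits squares the signs away.
      refine locallyConj_of_pauli hA hA hAσ hAσ fun k => ?_
      rw [Function.comp_apply, Equiv.swap_apply_self]
      split_ifs <;> ring
    exact h.trans (ih (c ∘ Equiv.swap x y))

theorem locallyConj_signs {ε : Fin 3 → ℤˣ} (hε : ∏ i, ε i = 1) (c : Fin 3 → ℝ) :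
    LocallyConj c fun i => ((ε i : ℤ) : ℝ) * c i := by
  -- A half-turn about axis `l` on one qubit alone reverses the other two coordinates; these and the
  -- identity are all the even sign changes.
  have hflip : ∀ l : Fin 3, LocallyConj c fun i => (if i = l then 1 else -1) * c i := by
    intro l
    refine locallyConj_of_pauli (π := 1) (s := 1) (r := fun i => if i = l then 1 else -1)
      (I_smul_pauli_mem l) (one_mem _) (fun k => ?_) (fun k => by simp) fun k => by
        by_cases h : k = l <;> simp [h]
    ext a b
    fin_cases l <;> fin_cases k <;> fin_cases a <;> fin_cases b <;>
      simp [pauli, mul_apply, Fin.sum_univ_two]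
  have hcongr : ∀ d e : Fin 3 → ℝ, LocallyConj c d → (∀ i, e i = d i) → LocallyConj c e :=
    fun d e h he => by rwa [funext he]
  rcases units_cases hε with ⟨e0, e1, e2⟩ | ⟨e0, e1, e2⟩ | ⟨e0, e1, e2⟩ | ⟨e0, e1, e2⟩
  · refine hcongr _ _ (LocallyConj.refl c) fun i => ?_
    fin_cases i <;> simp [e0, e1, e2]
  · refine hcongr _ _ (hflip 0) fun i => ?_
    fin_cases i <;> simp [e0, e1, e2]
  · refine hcongr _ _ (hflip 1) fun i => ?_
    fin_cases i <;> simp [e0, e1, e2]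
  · refine hcongr _ _ (hflip 2) fun i => ?_
    fin_cases i <;> simp [e0, e1, e2]

theorem locallyConj_of_mem_weylOrbit {c d : Fin 3 → ℝ} (h : d ∈ weylOrbit c) :
    LocallyConj c d := by
  obtain ⟨σ, ε, hε, rfl⟩ := h
  exact (locallyConj_comp_perm σ c).trans (locallyConj_signs hε (c ∘ σ))

end TwoQubit

namespace TwoQubit

/-! ### Spectral bounds for mixtures of conjugates -/

/-- The unnormalized Bell basis, as columns. -/
noncomputable def bell : Op := fun p q =>
  match q with
  | (0, 0) => if p = (0, 0) ∨ p = (1, 1) then 1 else 0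
  | (0, 1) => if p = (0, 1) ∨ p = (1, 0) then 1 else 0
  | (1, 0) => if p = (0, 1) then 1 else if p = (1, 0) then -1 else 0
  | (1, 1) => if p = (0, 0) then 1 else if p = (1, 1) then -1 else 0

/-- The eigenvalues of `∑ j, c j • σ_j ⊗ σ_j` on the Bell basis. -/
def bellEigenvalue (c : Fin 3 → ℝ) : Fin 2 × Fin 2 → ℝ
  | (0, 0) => c 0 - c 1 + c 2
  | (0, 1) => c 0 + c 1 - c 2
  | (1, 0) => -c 0 - c 1 - c 2
  | (1, 1) => -c 0 + c 1 + c 2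

theorem conjTranspose_bell_mul_bell : bellᴴ * bell = (2 : ℂ) • (1 : Op) := by
  ext ⟨a, b⟩ ⟨c, d⟩
  fin_cases a <;> fin_cases b <;> fin_cases c <;> fin_cases d <;>
    simp [mul_apply, bell, Fintype.sum_prod_type, one_apply] <;> norm_num

theorem bell_mul_conjTranspose_bell : bell * bellᴴ = (2 : ℂ) • (1 : Op) := by
  have h : ((2 : ℂ)⁻¹ • bellᴴ) * bell = 1 := by
    rw [smul_mul_assoc, conjTranspose_bell_mul_bell, smul_smul]
    norm_num
  have h' := mul_eq_one_comm.1 h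
  rw [mul_smul_comm] at h'
  rw [← h', smul_smul]
  norm_num

theorem cartan_mul_bell (c : Fin 3 → ℝ) : cartan c * bell =
    bell * diagonal fun q => Complex.I / 2 * (bellEigenvalue c q : ℂ) := by
  ext ⟨a, b⟩ ⟨x, y⟩
  rw [mul_diagonal]
  fin_cases a <;> fin_cases b <;> fin_cases x <;> fin_cases y <;>
    simp [mul_apply, cartan, couplingBasis, pauli, bell, bellEigenvalue, Fintype.sum_prod_type,
      Fin.sum_univ_three] <;> grind [Complex.I_mul_I]

/-- The imaginary part of the diagonal entry at `q` in the Bell basis, scaled by two. -/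
noncomputable def bellDiag (q : Fin 2 × Fin 2) : Op →ₗ[ℝ] ℝ where
  toFun X := ((bellᴴ * X * bell) q q).im
  map_add' X Y := by simp [mul_add, add_mul]
  map_smul' r X := by simp

theorem continuous_bellDiag (q : Fin 2 × Fin 2) : Continuous (bellDiag q) := by
  change Continuous fun X : Op => ((bellᴴ * X * bell) q q).im
  fun_prop

theorem bell_conj_cartan (c : Fin 3 → ℝ) : bellᴴ * cartan c * bell =
    diagonal fun q => Complex.I * (bellEigenvalue c q : ℂ) := by
  rw [mul_assoc, cartan_mul_bell, ← mul_assoc, conjTranspose_bell_mul_bell, smul_mul_assoc,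
    one_mul]
  ext p q
  simp only [Matrix.smul_apply, diagonal_apply, smul_eq_mul]
  split_ifs <;> ring

theorem bellDiag_cartan (c : Fin 3 → ℝ) (q : Fin 2 × Fin 2) :
    bellDiag q (cartan c) = bellEigenvalue c q := by
  change ((bellᴴ * cartan c * bell) q q).im = _
  simp [bell_conj_cartan]

/-- Conjugation by a unitary operator acts on diagonals by a doubly stochastic matrix. -/
theorem exists_bellDiag_conj {U : Op} (hU : U ∈ unitary Op) (c : Fin 3 → ℝ) :
    ∃ S : Fin 2 × Fin 2 → Fin 2 × Fin 2 → ℝ, (∀ q p, 0 ≤ S q p) ∧ (∀ q, ∑ p, S q p = 1) ∧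
      (∀ p, ∑ q, S q p = 1) ∧
      ∀ q, bellDiag q (U * cartan c * star U) = ∑ p, S q p * bellEigenvalue c p := by
  -- This is `U` in the normalized Bell basis; the squared moduli of its entries form the doubly
  -- stochastic matrix.
  set V : Op := (2 : ℂ)⁻¹ • (bellᴴ * U * bell) with hV
  have hVb : V * bellᴴ = bellᴴ * U := by
    rw [hV, smul_mul_assoc, mul_assoc _ bell, bell_mul_conjTranspose_bell, mul_smul_comm,
      smul_smul, mul_one]
    norm_num
  have hbV : bell * Vᴴ = star U * bell := by
    simpa [star_eq_conjTranspose] using congr_arg conjTranspose hVb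
  have hVV : V * Vᴴ = 1 := by
    have : (2 : ℂ) • (V * Vᴴ) = (2 : ℂ) • (1 : Op) := by
      calc (2 : ℂ) • (V * Vᴴ) = V * ((2 : ℂ) • 1) * Vᴴ := by simp
        _ = V * bellᴴ * (bell * Vᴴ) := by
          rw [← conjTranspose_bell_mul_bell]; simp only [mul_assoc]
        _ = bellᴴ * (U * star U) * bell := by rw [hVb, hbV]; simp only [mul_assoc]
        _ = _ := by
          rw [Unitary.mul_star_self_of_mem hU, mul_one, conjTranspose_bell_mul_bell]
    exact smul_right_injective Op (two_ne_zero' ℂ) this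
  have hVV' : Vᴴ * V = 1 := mul_eq_one_comm.1 hVV
  refine ⟨fun q p => Complex.normSq (V q p), fun q p => Complex.normSq_nonneg _, fun q => ?_,
    fun p => ?_, fun q => ?_⟩
  · have h := congr_arg Complex.re (congr_fun (congr_fun hVV q) q)
    rw [mul_apply, one_apply_eq, Complex.re_sum] at h
    rw [← Complex.one_re, ← h]
    refine Finset.sum_congr rfl fun p _ => ?_
    rw [conjTranspose_apply, Complex.star_def, Complex.mul_conj, Complex.ofReal_re]
  · have h := congr_arg Complex.re (congr_fun (congr_fun hVV' p) p)
    rw [mul_apply, one_apply_eq, Complex.re_sum] at h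
    rw [← Complex.one_re, ← h]
    refine Finset.sum_congr rfl fun q _ => ?_
    rw [conjTranspose_apply, Complex.star_def, mul_comm, Complex.mul_conj, Complex.ofReal_re]
  · have h : bellᴴ * (U * cartan c * star U) * bell =
        V * (diagonal fun q => Complex.I * (bellEigenvalue c q : ℂ)) * Vᴴ := by
      rw [← bell_conj_cartan]
      calc bellᴴ * (U * cartan c * star U) * bell
          = (bellᴴ * U) * cartan c * (star U * bell) := by simp only [mul_assoc]
        _ = _ := by rw [← hVb, ← hbV]; simp only [mul_assoc]
    change ((bellᴴ * (U * cartan c * star U) * bell) q q).im = _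
    rw [h, mul_apply, Complex.im_sum]
    refine Finset.sum_congr rfl fun p _ => ?_
    rw [mul_diagonal, conjTranspose_apply, Complex.star_def]
    have : V q p * (Complex.I * (bellEigenvalue c p : ℂ)) * (starRingEnd ℂ) (V q p) =
        ((Complex.normSq (V q p) * bellEigenvalue c p : ℝ) : ℂ) * Complex.I := by
      push_cast
      rw [← Complex.mul_conj]
      ring
    rw [this]
    simp

/-- In the chamber the eigenvalues decrease in the order `(0, 1)`, `(0, 0)`, `(1, 1)`, `(1, 0)`. An
average lies between the extremes, and two diagonal entries sum to at most the two largest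
eigenvalues, `2 * c 0`. -/
theorem bellDiag_conj_le {U : Op} (hU : U ∈ unitary Op) {c : Fin 3 → ℝ}
    (hc : c ∈ closedFundamentalWeylChamber) :
    bellDiag (0, 1) (U * cartan c * star U) ≤ c 0 + c 1 - c 2 ∧
    -(c 0 + c 1 + c 2) ≤ bellDiag (1, 0) (U * cartan c * star U) ∧
    bellDiag (0, 0) (U * cartan c * star U) + bellDiag (0, 1) (U * cartan c * star U) ≤
      2 * c 0 := by
  obtain ⟨S, hS, hrow, hcol, h⟩ := exists_bellDiag_conj hU c
  obtain ⟨h1, h2, h3, h4, h5, h6⟩ := hc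
  simp only [Fintype.sum_prod_type, Fin.sum_univ_two] at hrow hcol h
  rw [h, h, h]
  simp only [bellEigenvalue]
  have r0 := hrow (0, 0)
  have r1 := hrow (0, 1)
  have r2 := hrow (1, 0)
  have k := hcol (0, 1)
  refine ⟨?_, ?_, ?_⟩
  · nlinarith [mul_nonneg (hS (0, 1) (0, 0)) h1, mul_nonneg (hS (0, 1) (1, 0)) h5,
      mul_nonneg (hS (0, 1) (1, 1)) h3]
  · nlinarith [mul_nonneg (hS (1, 0) (0, 0)) h4, mul_nonneg (hS (1, 0) (0, 1)) h5,
      mul_nonneg (hS (1, 0) (1, 1)) h2]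
  -- The column sum keeps the two rows together from giving the top eigenvalue weight above `1`; the
  -- remaining weight sees at most the second eigenvalue.
  · have k1 : 0 ≤ 1 - (S (0, 0) (0, 1) + S (0, 1) (0, 1)) := by
      linarith [hS (1, 0) (0, 1), hS (1, 1) (0, 1)]
    nlinarith [mul_nonneg k1 h1, mul_nonneg (hS (0, 0) (1, 0)) h4, mul_nonneg (hS (0, 0) (1, 1)) h6,
      mul_nonneg (hS (0, 1) (1, 0)) h4, mul_nonneg (hS (0, 1) (1, 1)) h6]

end TwoQubit

/-! ### Reduction to the Weyl chamber and the equivalence -/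

namespace TwoQubit

/-- The diagonal bounds are linear and continuous in the operator, so they survive weighted, even
infinite, sums. -/
theorem bounds_of_hasSum_conj {c d : Fin 3 → ℝ} (hc : c ∈ closedFundamentalWeylChamber)
    {τ : ℕ → ℝ} {W : ℕ → Op} {t : ℝ} (hτ : ∀ j, 0 ≤ τ j) (hW : ∀ j, W j ∈ localUnitaries)
    (ht : HasSum τ t) (h : HasSum (fun j => τ j • (W j * cartan c * (W j)⁻¹)) (cartan d)) :
    d 0 ≤ t * c 0 ∧ d 0 + d 1 + d 2 ≤ t * (c 0 + c 1 + c 2) ∧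
      d 0 + d 1 - d 2 ≤ t * (c 0 + c 1 - c 2) := by
  have hq : ∀ q, HasSum (fun j => τ j * bellDiag q (W j * cartan c * star (W j)))
      (bellEigenvalue d q) := fun q => by
    have := h.map (bellDiag q) (continuous_bellDiag q)
    rw [bellDiag_cartan] at this
    convert this using 1
    funext j
    rw [Function.comp_apply, map_smul, smul_eq_mul, inv_eq_star (hW j)]
  have hb := fun j => bellDiag_conj_le (localUnitaries_subset_unitary (hW j)) hc
  have e1 := hasSum_le (fun j => by
    rw [← mul_add]; exact mul_le_mul_of_nonneg_left (hb j).2.2 (hτ j))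
    ((hq (0, 0)).add (hq (0, 1))) (ht.mul_right (2 * c 0))
  have e2 := hasSum_le (fun j => mul_le_mul_of_nonneg_left (hb j).2.1 (hτ j))
    (ht.mul_right (-(c 0 + c 1 + c 2))) (hq (1, 0))
  have e3 := hasSum_le (fun j => mul_le_mul_of_nonneg_left (hb j).1 (hτ j))
    (hq (0, 1)) (ht.mul_right (c 0 + c 1 - c 2))
  simp only [bellEigenvalue] at e1 e2 e3
  exact ⟨by linarith, by linarith, by linarith⟩

theorem exists_conj_sOrdered {H L : Op} {a : Fin 3 → ℝ} (hL : L ∈ localUnitaries)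
    (ha : cartan a = Ad L (Complex.I • H)) :
    ∃ M ∈ localUnitaries, Complex.I • H = M * cartan (sOrdered a) * M⁻¹ := by
  obtain ⟨U, hU, h⟩ := locallyConj_of_mem_weylOrbit (mem_weylOrbit_sOrdered a)
  refine ⟨L * U, mul_mem_localUnitaries hL hU, ?_⟩
  rw [Matrix.mul_inv_rev]
  calc Complex.I • H = L * L⁻¹ * (Complex.I • H) * (L * L⁻¹) := by
        rw [mul_inv_self hL, one_mul, mul_one]
    _ = L * Ad L (Complex.I • H) * L⁻¹ := by rw [Ad]; simp only [mul_assoc]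
    _ = _ := by rw [← ha, h]; simp only [mul_assoc]

theorem cartan_sum_smul {ι : Type*} [Fintype ι] (w : ι → ℝ) (z : ι → Fin 3 → ℝ) :
    cartan (∑ i, w i • z i) = ∑ i, w i • cartan (z i) := by
  simp only [cartan, Finset.sum_apply, Pi.smul_apply, smul_eq_mul, Finset.sum_smul,
    Finset.smul_sum, smul_smul]
  exact Finset.sum_comm

theorem smul_mem_weylOrbit {t : ℝ} {c z : Fin 3 → ℝ} (hz : z ∈ weylOrbit (t • c)) :
    ∃ z' ∈ weylOrbit c, z = t • z' := by
  obtain ⟨σ, ε, hε, rfl⟩ := hz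
  refine ⟨_, ⟨σ, ε, hε, rfl⟩, ?_⟩
  funext i
  simp only [Pi.smul_apply, smul_eq_mul]
  ring

theorem simulates_of_mixture {H H' : Op} {t : ℝ} {ι : Type*} [Fintype ι] {τ : ι → ℝ} {W : ι → Op}
    (hτ : ∀ i, 0 ≤ τ i) (hW : ∀ i, W i ∈ localUnitaries) (ht : ∑ i, τ i = t)
    (hH : Complex.I • H' = ∑ i, τ i • (W i * (Complex.I • H) * (W i)⁻¹)) : Simulates H H' t := by
  set e := (Fintype.equivFin ι).symm
  refine simulates_of_sum (n := Fintype.card ι)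
    (τ := fun j => if h : j < Fintype.card ι then τ (e ⟨j, h⟩) else 0)
    (W := fun j => if h : j < Fintype.card ι then W (e ⟨j, h⟩) else 1) (fun j => ?_) (fun j => ?_)
    ?_ ?_
  · split_ifs
    exacts [hτ _, le_rfl]
  · split_ifs
    exacts [hW _, one_mem_localUnitaries]
  · rw [← ht, ← Equiv.sum_comp e, Finset.sum_range]
    simp
  · rw [hH, ← Equiv.sum_comp e, Finset.sum_range]
    simp

theorem simulates_iff_sMajorized {H H' L L' : Op} {a a' : Fin 3 → ℝ} (hL : L ∈ localUnitaries)
    (hL' : L' ∈ localUnitaries) (ha : cartan a = Ad L (Complex.I • H))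
    (ha' : cartan a' = Ad L' (Complex.I • H')) {t : ℝ} (ht : 0 ≤ t) :
    Simulates H H' t ↔ SMajorized a' (t • a) := by
  obtain ⟨M, hM, hH⟩ := exists_conj_sOrdered hL ha
  obtain ⟨M', hM', hH'⟩ := exists_conj_sOrdered hL' ha'
  have hc := sOrdered_mem_chamber a
  have hc' := sOrdered_mem_chamber a'
  rw [SMajorized, sOrdered_smul ht]
  set c := sOrdered a
  set c' := sOrdered a'
  simp only [Pi.smul_apply, smul_eq_mul]
  constructor
  · intro hS
    obtain ⟨τ, W, hτ, hW, hsum, h⟩ := hS.exists_hasSum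
    -- The conjugators are rewritten between the normal forms of `H` and `H'`.
    have hY : ∀ j, M'⁻¹ * W j * M ∈ localUnitaries := fun j =>
      mul_mem_localUnitaries (mul_mem_localUnitaries (inv_mem_localUnitaries hM') (hW j)) hM
    have h' : HasSum (fun j => τ j • (M'⁻¹ * W j * M * cartan c * (M'⁻¹ * W j * M)⁻¹))
        (cartan c') := by
      have h1 := (h.mul_left M'⁻¹).mul_right M'
      have h2 : M'⁻¹ * (Complex.I • H') * M' = cartan c' := by
        calc M'⁻¹ * (Complex.I • H') * M' = (M'⁻¹ * M') * cartan c' * (M'⁻¹ * M') := by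
              rw [hH']; simp only [mul_assoc]
          _ = _ := by rw [inv_mul_self hM', one_mul, mul_one]
      rw [h2] at h1
      have h3 : ∀ j, τ j • (M'⁻¹ * W j * M * cartan c * (M'⁻¹ * W j * M)⁻¹) =
          M'⁻¹ * τ j • (W j * (Complex.I • H) * (W j)⁻¹) * M' := fun j => by
        rw [mul_smul_comm, smul_mul_assoc, hH, Matrix.mul_inv_rev, Matrix.mul_inv_rev,
          inv_inv_self hM']
        simp only [mul_assoc]
      simp only [h3]
      exact h1
    obtain ⟨h1, h2, h3⟩ := bounds_of_hasSum_conj hc hτ hY hsum h'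
    exact ⟨h1, by linarith, by linarith⟩
  · rintro ⟨h1, h2, h3⟩
    have hmem := mem_convexHull_weylOrbit (y := t • c) hc' h1 h2 h3
    obtain ⟨ι, _, w, z, hw, hw1, hz, hsum⟩ := mem_convexHull_iff_exists_fintype.1 hmem
    choose z' hz' hzz using fun i => smul_mem_weylOrbit (hz i)
    choose U hU hUz using fun i => locallyConj_of_mem_weylOrbit (hz' i)
    -- Orbit points of `t • c` are `t` times orbit points of `c`, so the factor `t` goes into the
    -- durations, which then sum to `t`.
    refine simulates_of_mixture (τ := fun i => w i * t) (W := fun i => M' * U i * M⁻¹)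
      (fun i => mul_nonneg (hw i) ht) (fun i => mul_mem_localUnitaries
        (mul_mem_localUnitaries hM' (hU i)) (inv_mem_localUnitaries hM)) ?_ ?_
    · rw [← Finset.sum_mul, hw1, one_mul]
    · have hc'' : cartan c' = ∑ i, (w i * t) • (U i * cartan c * (U i)⁻¹) := by
        rw [← hsum]
        simp only [hzz, smul_smul]
        rw [cartan_sum_smul]
        simp only [hUz]
      rw [hH', hc'', Finset.mul_sum, Finset.sum_mul]
      refine Finset.sum_congr rfl fun i _ => ?_
      rw [mul_smul_comm, smul_mul_assoc, hH, Matrix.mul_inv_rev, Matrix.mul_inv_rev,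
        inv_inv_self hM]
      congr 1
      calc M' * (U i * cartan c * (U i)⁻¹) * M'⁻¹
          = M' * U i * 1 * cartan c * 1 * ((U i)⁻¹ * M'⁻¹) := by
            simp only [mul_assoc, one_mul]
        _ = _ := by rw [← inv_mul_self hM]; simp only [mul_assoc]

end TwoQubit

theorem mainTheorem4 (H H' : TwoQubit.Op)
    (hH : TwoQubit.IsNonlocalHamiltonian H) (hH' : TwoQubit.IsNonlocalHamiltonian H')
    (a a' : Fin 3 → ℝ) (L L' : TwoQubit.Op)
    (hL : L ∈ TwoQubit.localUnitaries) (hL' : L' ∈ TwoQubit.localUnitaries)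
    (ha : TwoQubit.cartan a = TwoQubit.Ad L (Complex.I • H))
    (ha' : TwoQubit.cartan a' = TwoQubit.Ad L' (Complex.I • H')) :
    (a ∈ TwoQubit.closedFundamentalWeylChamber →
      a' ∈ TwoQubit.closedFundamentalWeylChamber →
      ∀ t : ℝ, 0 < t →
        (TwoQubit.Simulates H H' t ↔
          a 0 ≥ a' 0 / t ∧
          a 0 + a 1 + a 2 ≥ (a' 0 + a' 1 + a' 2) / t ∧
          a 0 + a 1 - a 2 ≥ (a' 0 + a' 1 - a' 2) / t)) ∧
    (∀ t : ℝ, 0 ≤ t →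
      (TwoQubit.Simulates H H' t ↔ TwoQubit.SMajorized a' (t • a))) := by
  have key := fun t ht => TwoQubit.simulates_iff_sMajorized (t := t) hL hL' ha ha' ht
  refine ⟨fun hc hc' t ht => ?_, key⟩
  rw [key t ht.le, TwoQubit.SMajorized, TwoQubit.sOrdered_smul ht.le, TwoQubit.sOrdered_eq_self hc,
    TwoQubit.sOrdered_eq_self hc', ge_iff_le, ge_iff_le, ge_iff_le, div_le_iff₀ ht, div_le_iff₀ ht,
    div_le_iff₀ ht]
  simp only [Pi.smul_apply, smul_eq_mul]
  constructor <;> rintro ⟨h1, h2, h3⟩ <;> exact ⟨by linarith, by linarith, by linarith⟩
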